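/- Let $(R,\mathfrak m,k)$ be a one-dimensional Noetherian local ring with infinite residue field $k$. For a finitely generated $R$-module $M$ and a submodule $N\subseteq M$, call an integer $h\ge 0$ an Artin–Rees number of $(N,M)$ if $$I^nM\cap N=I^{\,n-h}\bigl(I^hM\cap N\bigr)\qquad\text{for all } n\ge h \text{ and all ideals } I\subseteq R,$$ and let $\mathrm{ar}_R(N,M)$ be the least Artin–Rees number of $(N,M)$ (with $\mathrm{ar}_R(N,M)=\infty$ if there is none). Write $H^0_{\mathfrak m}(M/N)$ for the submodule of $M/N$ of elements annihilated by some power of $\mathfrak m$, and $\ell$ for length. Then: 1. $R$ has the strong uniform Artin–Rees property: every pair $N\subseteq M$ with $M$ finitely generated has an Artin–Rees number (one $h$, depending on $N\subseteq M$, that works for all ideals $I$). 2. There is an integer $r\ge 0$ such that every $\mathfrak m$-primary ideal $I$ of $R$ contains an element $y$ with $I^n=yI^{n-1}$ for all $n\ge \max\{r,1\}$. 3. For every integer $r\ge 0$ as in 2, every finitely generated $R$-module $M$ and every submodule $N\subseteq M$, the module $H^0_{\mathfrak m}(M/N)$ has finite length and $$\mathrm{ar}_R(N,M)\le \max\bigl\{r,\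 \ell(H^0_{\mathfrak m}(M/N))\bigr\}+\ell(H^0_{\mathfrak m}(M/N)).$$ -/

import Mathlib

universe u v

namespace ArtinRees

/-- `h` is an Artin-Rees number for the pair `(N, M)` with respect to the ideal `I`:
`I^n M ∩ N = I^(n-h) (I^h M ∩ N)` for all `n ≥ h`. -/
def StrongEq {R : Type*} [CommRing R] {M : Type*} [AddCommGroup M] [Module R M]
    (I : Ideal R) (N : Submodule R M) (h : ℕ) : Prop :=
  ∀ n : ℕ, h ≤ n →
    I ^ n • (⊤ : Submodule R M) ⊓ N = I ^ (n - h) • (I ^ h • (⊤ : Submodule R M) ⊓ N)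

/-- `h` is an Artin-Rees number for the pair `(N, M)` with respect to the family of all ideals. -/
def IsArtinReesNumber {R : Type*} [CommRing R] {M : Type*} [AddCommGroup M] [Module R M]
    (N : Submodule R M) (h : ℕ) : Prop :=
  ∀ I : Ideal R, StrongEq I N h

/-- The pair `(N, M)` has the strong (uniform) Artin-Rees property: a single `h` works for all
ideals. -/
def HasStrongArtinRees {R : Type*} [CommRing R] {M : Type*} [AddCommGroup M] [Module R M]
    (N : Submodule R M) : Prop :=
  ∃ h : ℕ, IsArtinReesNumber N h

/-- The number `ar_R(N, M)`: the least Artin-Rees number of the pair `(N, M)` with respect to all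
ideals, and `⊤` (infinity) if there is none. -/
noncomputable def ar {R : Type*} [CommRing R] {M : Type*} [AddCommGroup M] [Module R M]
    (N : Submodule R M) : ℕ∞ :=
  ⨅ (h : ℕ) (_ : IsArtinReesNumber N h), (h : ℕ∞)

/-- The ring `R` has the strong uniform Artin-Rees property: every pair `N ⊆ M` with `M` finitely
generated has it. -/
def RingHasStrongUniformArtinRees (R : Type u) [CommRing R] : Prop :=
  ∀ (M : Type v) [AddCommGroup M] [Module R M] [Module.Finite R M] (N : Submodule R M),
    HasStrongArtinRees N

/-- `r` is a uniform reduction bound for the local ring `R`: every `m`-primary ideal `I` contains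
an element `y` with `I^n = y I^(n-1)` for all `n ≥ r` (`n ≥ 1`, so that the exponent `n - 1` makes
sense). -/
def IsUniformReductionBound (R : Type*) [CommRing R] [IsLocalRing R] (r : ℕ) : Prop :=
  ∀ I : Ideal R, I.IsPrimary → I.radical = IsLocalRing.maximalIdeal R →
    ∃ y ∈ I, ∀ n : ℕ, 1 ≤ n → r ≤ n → I ^ n = Ideal.span {y} * I ^ (n - 1)

/-- The zeroth local cohomology `H^0_m(M)` of a module over a local ring: the submodule of all
elements annihilated by some power of the maximal ideal. -/
abbrev H0 (R : Type*) [CommRing R] [IsLocalRing R] (M : Type*) [AddCommGroup M] [Module R M] :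
    Submodule R M :=
  Ideal.primaryComponent M (IsLocalRing.maximalIdeal R)

end ArtinRees

/-! Suppose I is 𝔪-primary and I^(n+1) = y I^n for n ≥ r. An element of I^(r+l+k) M ∩ N is y^(l+k) v
with v in I^r M, and y is a parameter, so v has 𝔪-power torsion class in M/N. With l = ℓ(H⁰(M/N)),
𝔪^l kills that torsion; hence y^l v is already in N, and r + l is an Artin–Rees number.

A uniform r exists because, for a parameter x, every power of I needs at most ℓ(R/xR) generators
(`length_component_le`); Eakin–Sathaye turns a power with few generators into a principal reduction.

Any other proper I is approximated by the 𝔪-primary ideals I + 𝔪^t, and Krull's intersection theorem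
removes the error (`strongEq_of_forall_sup_pow`). -/

namespace Submodule

/-! ### Eakin–Sathaye over an infinite field -/

variable {k A : Type*} [Field k] [CommRing A] [Algebra k A]

/-- Over an infinite field, if multiplication by `y` maps `U` onto a finite-dimensional `W` and
`w` maps `U` into `W`, then some `w + t y` maps `U` onto `W`. -/
lemma exists_span_singleton_add_smul_mul_eq [Infinite k] {U W : Submodule k A}
    [FiniteDimensional k W] {y w : A} (hy : span k {y} * U = W) (hw : span k {w} * U ≤ W) :
    ∃ t : k, span k {w + t • y} * U = W := by
  have hyU (u : U) : y * u ∈ W := hy ▸ mul_mem_mul (mem_span_singleton_self y) u.2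
  have hwU (u : U) : w * u ∈ W := hw (mul_mem_mul (mem_span_singleton_self w) u.2)
  let φ : U →ₗ[k] W := ((LinearMap.mulLeft k y).comp U.subtype).codRestrict W hyU
  let ψ : U →ₗ[k] W := ((LinearMap.mulLeft k w).comp U.subtype).codRestrict W hwU
  have hφ : LinearMap.range φ = ⊤ := by
    refine LinearMap.range_eq_top.2 fun x ↦ ?_
    obtain ⟨u, hu, h⟩ := mem_span_singleton_mul.1 (hy.symm ▸ x.2 : (x : A) ∈ span k {y} * U)
    exact ⟨⟨u, hu⟩, Subtype.ext h⟩
  obtain ⟨s, hs⟩ := φ.exists_rightInverse_of_surjective hφ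
  -- Since (w - t y) s(v) = f(v) - t v, any t outside the finite spectrum of f makes w - t y map U
  -- onto W.
  let f : Module.End k W := ψ ∘ₗ s
  obtain ⟨t, ht⟩ := (Module.End.finite_spectrum f).exists_notMem
  rw [spectrum.notMem_iff] at ht
  refine ⟨-t, le_antisymm ?_ fun x hx ↦ ?_⟩
  · rw [mul_le]
    intro m hm u hu
    obtain ⟨c, rfl⟩ := mem_span_singleton.1 hm
    rw [smul_mul_assoc, add_mul, smul_mul_assoc]
    exact W.smul_mem _ (W.add_mem (hwU ⟨u, hu⟩) (W.smul_mem _ (hyU ⟨u, hu⟩)))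
  · obtain ⟨v, hv⟩ := ((Module.End.isUnit_iff _).1 ht).2 ⟨x, hx⟩
    have hsv : y * (s v : A) = v := congrArg Subtype.val (LinearMap.congr_fun hs v)
    have hfv : (f v : A) = w * (s v : A) := rfl
    have hv' : t • (v : A) - f v = x := by
      simpa [Algebra.algebraMap_eq_smul_one] using congrArg Subtype.val hv
    refine mem_span_singleton_mul.2 ⟨-(s v : A), U.neg_mem (s v).2, ?_⟩
    rw [← hv', hfv, mul_neg, add_mul, smul_mul_assoc, hsv, neg_smul]
    ring

/-- The one-dimensional **Eakin–Sathaye theorem** for a finite-dimensional subspace `V` of a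
commutative algebra over an infinite field. -/
theorem le_span_setOf_span_singleton_mul_eq [Infinite k] {V : Submodule k A} (hV : V.FG) (n : ℕ)
    (a : A) (ha : Module.finrank k ↥(span k {a} * V ^ (n + 1)) ≤ n + 1) :
    V ≤ span k {z | z ∈ V ∧ span k {z} * (span k {a} * V ^ n) = span k {a} * V ^ (n + 1)} := by
  induction n using Nat.strong_induction_on generalizing a with | _ n ih =>
  have hfin (m : ℕ) (b : A) : FiniteDimensional k ↥(span k {b} * V ^ m) :=
    Module.Finite.iff_fg.2 ((fg_span_singleton b).mul (hV.pow m))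
  have hle {z : A} (hz : z ∈ V) (m : ℕ) (b : A) :
      span k {z} * (span k {b} * V ^ m) ≤ span k {b} * V ^ (m + 1) := by
    rw [mul_left_comm, pow_succ']
    exact mul_le_mul_right (mul_le_mul_left ((span_singleton_le_iff_mem z V).2 hz) _) _
  have hfin' := hfin (n + 1) a
  by_cases hex : ∃ y ∈ V, span k {y} * (span k {a} * V ^ n) = span k {a} * V ^ (n + 1)
  · obtain ⟨y, hyV, hy⟩ := hex
    intro w hw
    obtain ⟨t, ht⟩ := exists_span_singleton_add_smul_mul_eq hy (hle hw n a)
    rw [← add_sub_cancel_right w (t • y)]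
    exact sub_mem (subset_span ⟨V.add_mem hw (V.smul_mem t hyV), ht⟩)
      (smul_mem _ t (subset_span ⟨hyV, hy⟩))
  -- Take y maximizing dim y a V^n, now at most n. Induction with multiplier y a spans V by z with z
  -- y a V^(n-1) = y a V^n; then z a V^n contains y a V^n and equals it by maximality. So a V^(n+1)
  -- lies in y a V^n, a contradiction. For n = 0 the maximum is 0 and every z qualifies.
  exfalso
  let d : A → ℕ := fun z ↦ Module.finrank k ↥(span k {z} * (span k {a} * V ^ n))
  obtain ⟨y, hyV, hmax⟩ : ∃ y ∈ V, ∀ z ∈ V, d z ≤ d y := by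
    have hbdd : (d '' V).Finite := (Set.finite_Iic (n + 1)).subset <| by
      rintro _ ⟨z, hz, rfl⟩
      exact (finrank_mono (hle hz n a)).trans ha
    obtain ⟨_, ⟨y, hy, rfl⟩, h⟩ := Set.exists_max_image _ id hbdd ⟨_, 0, V.zero_mem, rfl⟩
    exact ⟨y, hy, fun z hz ↦ h _ ⟨z, hz, rfl⟩⟩
  have hlt : d y < n + 1 :=
    (finrank_lt_finrank_of_lt ((hle hyV n a).lt_of_ne fun h ↦ hex ⟨y, hyV, h⟩)).trans_le ha
  suffices h : V ≤ span k {z | z ∈ V ∧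
      span k {z} * (span k {a} * V ^ n) = span k {y} * (span k {a} * V ^ n)} by
    refine hex ⟨y, hyV, (hle hyV n a).antisymm ?_⟩
    rw [pow_succ', mul_left_comm]
    refine (mul_le_mul_left h _).trans (mul_le.2 fun m hm u hu ↦ ?_)
    induction hm using span_induction with
    | mem z hz => exact hz.2 ▸ mul_mem_mul (mem_span_singleton_self z) hu
    | zero => simp
    | add _ _ _ _ h₁ h₂ => rw [add_mul]; exact add_mem h₁ h₂
    | smul c _ _ h₁ => rw [smul_mul_assoc]; exact smul_mem _ c h₁
  have heq {z : A} (hz : z ∈ V)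
      (h : span k {y} * (span k {a} * V ^ n) ≤ span k {z} * (span k {a} * V ^ n)) :
      span k {z} * (span k {a} * V ^ n) = span k {y} * (span k {a} * V ^ n) :=
    have : FiniteDimensional k ↥(span k {z} * (span k {a} * V ^ n)) := by
      rw [← mul_assoc, span_mul_span, Set.singleton_mul_singleton]; exact hfin n _
    (eq_of_le_of_finrank_le h (hmax z hz)).symm
  cases n with
  | zero =>
    have hy0 : span k {y} * (span k {a} * V ^ 0) = ⊥ := by
      have : FiniteDimensional k ↥(span k {y} * (span k {a} * V ^ 0)) := by
        rw [← mul_assoc, span_mul_span, Set.singleton_mul_singleton]; exact hfin 0 _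
      exact finrank_eq_zero.1 (Nat.lt_one_iff.1 hlt)
    exact fun z hz ↦ subset_span ⟨hz, heq hz (hy0 ▸ bot_le)⟩
  | succ n =>
    have hya (m : ℕ) : span k {y * a} * V ^ m = span k {y} * (span k {a} * V ^ m) := by
      rw [← mul_assoc, span_mul_span, Set.singleton_mul_singleton]
    refine (ih n n.lt_succ_self (y * a) (by rw [hya]; exact Nat.lt_succ_iff.1 hlt)).trans (span_mono ?_)
    rintro z ⟨hz, h⟩
    refine ⟨hz, heq hz ?_⟩
    rw [hya, hya] at h
    rw [← h]
    exact mul_le_mul_right (hle hyV n a) _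

end Submodule

/-! ### The fiber ring and Eakin–Sathaye for ideals -/

open Polynomial

namespace Ideal

variable {R : Type u} [CommRing R]

lemma coeff_mem_of_mem_map_algebraMap_reesAlgebra {I J : Ideal R} {b : reesAlgebra I}
    (hb : b ∈ J.map (algebraMap R (reesAlgebra I))) (i : ℕ) : (b : R[X]).coeff i ∈ J * I ^ i := by
  replace hb : b ∈ J • (⊤ : Submodule R (reesAlgebra I)) := by rwa [smul_top_eq_map]
  refine Submodule.smul_induction_on hb (fun r hr c _ ↦ ?_) fun c d hc hd ↦ ?_
  · simpa using mul_mem_mul hr (c.2 i)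
  · simpa using add_mem hc hd

end Ideal

namespace IsLocalRing

open Ideal

variable {R : Type u} [CommRing R] [IsLocalRing R]

/-- The fiber ring `⨁ I ^ n / 𝔪 I ^ n` of an ideal of a local ring. -/
def FiberRing (I : Ideal R) : Type u :=
  reesAlgebra I ⧸ (maximalIdeal R).map (algebraMap R (reesAlgebra I))

namespace FiberRing

variable (I : Ideal R)

noncomputable instance : CommRing (FiberRing I) :=
  inferInstanceAs (CommRing (reesAlgebra I ⧸ (maximalIdeal R).map (algebraMap R (reesAlgebra I))))

noncomputable instance : Algebra R (FiberRing I) :=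
  inferInstanceAs (Algebra R (reesAlgebra I ⧸ (maximalIdeal R).map (algebraMap R (reesAlgebra I))))

noncomputable instance : Algebra (IsLocalRing.ResidueField R) (FiberRing I) :=
  inferInstanceAs (Algebra (R ⧸ maximalIdeal R)
    (reesAlgebra I ⧸ (maximalIdeal R).map (algebraMap R (reesAlgebra I))))

instance : IsScalarTower R (IsLocalRing.ResidueField R) (FiberRing I) :=
  .of_algebraMap_eq fun _ ↦ rfl

/-- The projection from the Rees algebra to the fiber ring. -/
noncomputable def mk : reesAlgebra I →ₐ[R] FiberRing I :=
  Ideal.Quotient.mkₐ R _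

lemma mk_eq_mk {b c : reesAlgebra I} :
    mk I b = mk I c ↔ b - c ∈ (maximalIdeal R).map (algebraMap R (reesAlgebra I)) :=
  Ideal.Quotient.eq

/-- The class in the fiber ring of an element of `I ^ n`, in degree `n`. -/
noncomputable def monomial (n : ℕ) : ↥(I ^ n) →ₗ[R] FiberRing I where
  toFun c := mk I ⟨Polynomial.monomial n (c : R), reesAlgebra.monomial_mem.2 c.2⟩
  map_add' c d := by
    rw [← map_add]; congr 1; ext1; simp
  map_smul' r c := by
    rw [RingHom.id_apply, ← map_smul]
    congr 1; ext1
    simp [Polynomial.smul_monomial]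

lemma monomial_mul_monomial {i j n : ℕ} (h : i + j = n) (c : ↥(I ^ i)) (d : ↥(I ^ j)) :
    monomial I i c * monomial I j d =
      monomial I n ⟨c * d, h ▸ pow_add I i j ▸ mul_mem_mul c.2 d.2⟩ := by
  subst h
  simp only [monomial, LinearMap.coe_mk, AddHom.coe_mk]
  rw [← map_mul]; congr 1; ext1
  simp [Polynomial.monomial_mul_monomial]

lemma sub_mem_of_monomial_eq {n : ℕ} {c d : ↥(I ^ n)} (h : monomial I n c = monomial I n d) :
    (c - d : R) ∈ maximalIdeal R * I ^ n := by
  simpa using coeff_mem_of_mem_map_algebraMap_reesAlgebra ((mk_eq_mk I).1 h) n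

/-- The graded component of degree `n` of the fiber ring. -/
noncomputable def component (n : ℕ) : Submodule (ResidueField R) (FiberRing I) where
  __ := LinearMap.range (monomial I n)
  smul_mem' c x hx := by
    obtain ⟨r, rfl⟩ := residue_surjective c
    rw [← ResidueField.algebraMap_eq, algebraMap_smul]
    exact (LinearMap.range (monomial I n)).smul_mem r hx

variable {I}

lemma mem_component {n : ℕ} {x : FiberRing I} : x ∈ component I n ↔ ∃ c, monomial I n c = x :=
  Iff.rfl

/-- The fiber ring is generated in degree one, so the vector-space theorem for V = `component I 1`
controls all powers of I. -/
lemma component_one_pow (n : ℕ) : component I 1 ^ n = component I n := by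
  induction n with
  | zero =>
    rw [pow_zero]
    ext x
    rw [Submodule.mem_one, mem_component]
    have key (r : R) : algebraMap R (FiberRing I) r = monomial I 0 ⟨r, by simp⟩ := by
      rw [← (mk I).commutes]
      simp only [monomial, LinearMap.coe_mk, AddHom.coe_mk]
      congr 1
    constructor
    · rintro ⟨c, rfl⟩
      obtain ⟨r, rfl⟩ := residue_surjective c
      exact ⟨_, (key r).symm⟩
    · rintro ⟨c, rfl⟩
      exact ⟨residue R c, (key c)⟩
  | succ n ih =>
    rw [pow_succ', ih]
    apply le_antisymm
    · rw [Submodule.mul_le]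
      rintro _ ⟨c, rfl⟩ _ ⟨d, rfl⟩
      exact ⟨_, (monomial_mul_monomial I (add_comm 1 n) c d).symm⟩
    · rintro _ ⟨⟨c, hc⟩, rfl⟩
      have hc' := hc
      rw [pow_succ'] at hc'
      induction hc' using Submodule.mul_induction_on' with
      | mem_mul_mem a ha b hb =>
        have h := monomial_mul_monomial I (add_comm 1 n) ⟨a, by simpa using ha⟩ ⟨b, hb⟩
        exact h ▸ Submodule.mul_mem_mul ⟨_, rfl⟩ ⟨_, rfl⟩
      | add a ha b hb h₁ h₂ =>
        rw [← pow_succ'] at ha hb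
        have h := add_mem (h₁ ha) (h₂ hb)
        rwa [← map_add] at h

end FiberRing

open FiberRing in
/-- The one-dimensional **Eakin–Sathaye theorem** for a local ring. -/
theorem exists_pow_succ_eq_span_singleton_mul [IsNoetherianRing R] [Infinite (ResidueField R)]
    (I : Ideal R) (n : ℕ)
    (h : Module.finrank (ResidueField R) (component I (n + 1)) ≤ n + 1) :
    ∃ y ∈ I, I ^ (n + 1) = span {y} * I ^ n := by
  have hfg : (component I 1).FG := by
    have : Module.Finite R (component I 1) :=
      inferInstanceAs (Module.Finite R (LinearMap.range (monomial I 1)))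
    exact Module.Finite.iff_fg.1 (Module.Finite.of_restrictScalars_finite R _ _)
  have hspan := Submodule.le_span_setOf_span_singleton_mul_eq hfg n 1 (by
    rwa [← Submodule.one_eq_span, one_mul, component_one_pow])
  simp only [← Submodule.one_eq_span, one_mul, component_one_pow] at hspan
  obtain ⟨z, hz, hzn⟩ : ∃ z ∈ component I 1,
      -- The spanning set can be empty only when V = 0, and then z = 0 works.
      Submodule.span (ResidueField R) {z} * component I n = component I (n + 1) := by
    by_contra! hne
    have h0 : component I 1 = ⊥ := by
      rw [eq_bot_iff]
      refine hspan.trans (Submodule.span_le.2 fun z hz ↦ (hne z hz.1 hz.2).elim)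
    refine hne 0 (zero_mem _) ?_
    rw [← component_one_pow (n + 1), h0]
    simp [pow_succ]
  obtain ⟨⟨y, hy⟩, rfl⟩ := hz
  have hyI : y ∈ I := by simpa using hy
  refine ⟨y, hyI, le_antisymm ?_ ?_⟩
  -- Nakayama: the fiber ring only sees I^(n+1) ≤ y I^n + 𝔪 I^(n+1).
  · refine Submodule.le_of_le_smul_of_le_jacobson_bot (IsNoetherian.noetherian _)
      (maximalIdeal_le_jacobson _) (I := maximalIdeal R) fun c hc ↦ ?_
    have hc' : monomial I (n + 1) ⟨c, hc⟩ ∈ component I (n + 1) := ⟨_, rfl⟩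
    rw [← hzn] at hc'
    obtain ⟨_, ⟨d, rfl⟩, hd⟩ := Submodule.mem_span_singleton_mul.1 hc'
    rw [FiberRing.monomial_mul_monomial I (add_comm 1 n)] at hd
    have h := sub_mem_of_monomial_eq I hd.symm
    rw [← add_sub_cancel (y * d : R) c]
    exact Submodule.add_mem_sup (mul_mem_mul (mem_span_singleton_self y) d.2) h
  · rw [pow_succ']
    exact mul_mono_left ((span_singleton_le_iff_mem I).2 hyI)

end IsLocalRing

/-! ### Length and powers of the maximal ideal -/

namespace Module

variable {R M : Type*} [CommRing R] [AddCommGroup M] [Module R M]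

/-- Length is additive along `A ≤ B ≤ M`. -/
lemma length_quotient_eq_add {A B : Submodule R M} (h : A ≤ B) :
    length R (M ⧸ A) = length R (B ⧸ A.comap B.subtype) + length R (M ⧸ B) := by
  refine length_eq_add_of_exact ((A.comap B.subtype).mapQ A B.subtype le_rfl) (Submodule.factor h)
    ?_ (Submodule.factor_surjective h) ?_
  · rw [← LinearMap.ker_eq_bot, Submodule.ker_mapQ]
    exact Submodule.mkQ_map_self _
  · rw [LinearMap.exact_iff, Submodule.range_mapQ, Submodule.range_subtype, Submodule.factor,
      Submodule.ker_mapQ, Submodule.comap_id]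

/-- The annihilator contains a power of 𝔪, so M is a finite module over an Artinian quotient of R.
-/
lemma isFiniteLength_of_pow_maximalIdeal_smul_eq_bot [IsLocalRing R] [IsNoetherianRing R]
    [Module.Finite R M] {n : ℕ}
    (h : IsLocalRing.maximalIdeal R ^ n • (⊤ : Submodule R M) = ⊥) : IsFiniteLength R M := by
  cases subsingleton_or_nontrivial M with
  | inl _ => exact .of_subsingleton
  | inr _ =>
    let _ := quotientAnnihilator (R := R) (M := M)
    have _ : IsScalarTower R (R ⧸ annihilator R M) M :=
      (isTorsionBySet_annihilator R M).isScalarTower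
    have hle : IsLocalRing.maximalIdeal R ^ n ≤ annihilator R M := by
      rwa [← Submodule.annihilator_top, Submodule.le_annihilator_iff]
    have : IsArtinianRing (R ⧸ annihilator R M) := by
      refine IsLocalRing.quotient_artinian_of_mem_minimalPrimes_of_isLocalRing _
        ⟨⟨inferInstance, IsLocalRing.le_maximalIdeal ?_⟩, fun p hp _ ↦
          hp.1.le_of_pow_le (hle.trans hp.2)⟩
      rwa [Ne, annihilator_eq_top_iff, not_subsingleton_iff_nontrivial]
    have : Module.Finite (R ⧸ annihilator R M) M := .of_restrictScalars_finite R _ _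
    have : IsArtinian (R ⧸ annihilator R M) M := inferInstance
    rw [isFiniteLength_iff_isNoetherian_isArtinian]
    exact ⟨inferInstance, isArtinian_of_surjective_algebraMap
      (Ideal.Quotient.mk_surjective (I := annihilator R M))⟩

/-- A module of length at most `n` over a local ring is killed by `𝔪 ^ n`. -/
lemma pow_maximalIdeal_smul_top_eq_bot_of_length_le [IsLocalRing R] (n : ℕ)
    (h : length R M ≤ n) : IsLocalRing.maximalIdeal R ^ n • (⊤ : Submodule R M) = ⊥ := by
  induction n generalizing M with
  | zero =>
    have : Subsingleton M := length_eq_zero_iff.1 (by simpa using h)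
    exact Subsingleton.elim _ _
  | succ n ih =>
    cases subsingleton_or_nontrivial M with
    | inl _ => exact Subsingleton.elim _ _
    | inr _ =>
      have hfin : IsFiniteLength R M :=
        length_ne_top_iff.1 (h.trans_lt (ENat.natCast_lt_top _)).ne
      obtain ⟨_, _⟩ := isFiniteLength_iff_isNoetherian_isArtinian.1 hfin
      let N : Submodule R M := IsLocalRing.maximalIdeal R • ⊤
      -- By Nakayama 𝔪M is proper, so its length drops and induction applies to it.
      have hN : N ≠ ⊤ := fun hN ↦ top_ne_bot <|
        Submodule.eq_bot_of_le_smul_of_le_jacobson_bot _ _ (IsNoetherian.noetherian ⊤) hN.ge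
          (IsLocalRing.maximalIdeal_le_jacobson _)
      have hlt : length R N < n + 1 := (Submodule.length_lt hN).trans_le (by exact_mod_cast h)
      have h0 := congrArg (Submodule.map N.subtype) (ih (Order.lt_add_one_iff_of_not_isMax
        (by simp) |>.1 hlt))
      rwa [Submodule.map_smul'', Submodule.map_top, Submodule.range_subtype, Submodule.map_bot,
        ← Submodule.mul_smul, ← pow_succ] at h0

end Module

/-! ### Bounded reduction numbers in dimension one -/

namespace IsLocalRing

open Module

/-- For `J` of finite colength and any `x`, the length of `J / xJ` is at most that of `R / xR`. -/
lemma length_quotient_span_singleton_mul_le {R : Type*} [CommRing R] (J : Ideal R) (x : R)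
    (hJ : IsFiniteLength R (R ⧸ J)) :
    length R (J ⧸ Submodule.comap J.subtype (Ideal.span {x} * J)) ≤ length R (R ⧸ Ideal.span {x}) := by
  -- Compute ℓ(R/xJ) through J and through xR. As xR/xJ is a quotient of R/J, the finite ℓ(R/J)
  -- cancels.
  have h₁ := length_quotient_eq_add (Ideal.mul_le_right : Ideal.span {x} * J ≤ J)
  have h₂ := length_quotient_eq_add (Ideal.mul_le_left : Ideal.span {x} * J ≤ Ideal.span {x})
  let f : R →ₗ[R] Ideal.span {x} :=
    LinearMap.toSpanSingleton R _ ⟨x, Ideal.mem_span_singleton_self x⟩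
  have hf : J ≤ (Submodule.comap (Ideal.span {x}).subtype (Ideal.span {x} * J)).comap f := fun j hj ↦ by
    simpa [f, mul_comm j x] using Ideal.mul_mem_mul (Ideal.mem_span_singleton_self x) hj
  have h₃ : length R (Ideal.span {x} ⧸ Submodule.comap (Ideal.span {x}).subtype (Ideal.span {x} * J)) ≤
      length R (R ⧸ J) := by
    refine length_le_of_surjective (Submodule.mapQ _ _ f hf) ?_
    intro z
    obtain ⟨⟨y, hy⟩, rfl⟩ := Submodule.Quotient.mk_surjective _ z
    obtain ⟨a, rfl⟩ := Ideal.mem_span_singleton'.1 hy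
    exact ⟨Submodule.Quotient.mk a, rfl⟩
  have h₄ := h₁.symm.trans h₂ |>.trans_le (add_le_add_left h₃ _)
  rw [add_comm] at h₄
  exact (ENat.add_le_add_iff_left (length_ne_top_iff.2 hJ)).1 h₄

variable {R : Type u} [CommRing R] [IsLocalRing R]

lemma isFiniteLength_quotient_of_pow_le [IsNoetherianRing R] {J : Ideal R} {n : ℕ}
    (h : maximalIdeal R ^ n ≤ J) : IsFiniteLength R (R ⧸ J) := by
  refine isFiniteLength_of_pow_maximalIdeal_smul_eq_bot (n := n) ?_
  rw [← Submodule.range_mkQ J, ← Submodule.map_top, ← Submodule.map_smul'', eq_bot_iff,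
    Submodule.map_le_iff_le_comap, Submodule.comap_bot, Submodule.ker_mkQ]
  simpa using h

/-- A one-dimensional Noetherian local ring has a parameter. -/
lemma exists_isFiniteLength_quotient_span_singleton [IsNoetherianRing R]
    (hdim : ringKrullDim R = 1) :
    ∃ x ∈ maximalIdeal R, IsFiniteLength R (R ⧸ Ideal.span {x}) := by
  have hh : (maximalIdeal R).height = 1 := by
    have := maximalIdeal_height_eq_ringKrullDim (R := R)
    rw [hdim] at this
    exact_mod_cast this
  obtain ⟨s, hs, hcard⟩ := (maximalIdeal R).exists_finset_card_eq_height_of_isNoetherianRing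
  rw [hh] at hcard
  obtain ⟨x, rfl⟩ := Finset.card_eq_one.1 (by exact_mod_cast hcard : s.card = 1)
  rw [Finset.coe_singleton] at hs
  have := quotient_artinian_of_mem_minimalPrimes_of_isLocalRing _ hs
  obtain ⟨n, hn⟩ := exists_maximalIdeal_pow_le_of_isArtinianRing_quotient (Ideal.span {x})
  exact ⟨x, hs.1.2 (Ideal.mem_span_singleton_self x), isFiniteLength_quotient_of_pow_le hn⟩

open Ideal FiberRing in
-- The component is I^n/𝔪I^n, a quotient of I^n/xI^n because x is in 𝔪. The bound depends on neither
-- I nor n.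
lemma length_component_le (I : Ideal R) (n : ℕ) {x : R} (hx : x ∈ maximalIdeal R)
    (hI : IsFiniteLength R (R ⧸ I ^ n)) :
    length (ResidueField R) (component I n) ≤ length R (R ⧸ Ideal.span {x}) := by
  refine le_trans (le_of_eq_of_le (length_eq_of_surjective residue_surjective).symm ?_)
    (length_quotient_span_singleton_mul_le (I ^ n) x hI)
  refine length_le_of_surjective (M := ↥(I ^ n) ⧸ Submodule.comap (I ^ n).subtype (Ideal.span {x} * I ^ n))
    (Submodule.liftQ _ (monomial I n).rangeRestrict ?_) ?_
  · rintro ⟨c, hc⟩ hcx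
    obtain ⟨d, hd, rfl⟩ := Ideal.mem_span_singleton_mul.1 (Submodule.mem_comap.1 hcx)
    have h0 : x • monomial I n ⟨d, hd⟩ = 0 := by
      rw [← algebraMap_smul (ResidueField R), ResidueField.algebraMap_eq,
        (residue_eq_zero_iff x).2 hx, zero_smul]
    rw [← map_smul] at h0
    exact Subtype.ext h0
  · rintro ⟨_, c, rfl⟩
    exact ⟨Submodule.Quotient.mk c, rfl⟩

/-- Over a one-dimensional Noetherian local ring with infinite residue field, the reduction numbers
of the `𝔪`-primary ideals with respect to principal reductions are bounded. -/
theorem exists_forall_pow_succ_eq_span_singleton_mul [IsNoetherianRing R]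
    [Infinite (ResidueField R)] (hdim : ringKrullDim R = 1) :
    ∃ r : ℕ, ∀ I : Ideal R, I.radical = maximalIdeal R →
      ∃ y ∈ I, ∀ n : ℕ, r ≤ n → I ^ (n + 1) = Ideal.span {y} * I ^ n := by
  obtain ⟨x, hx, hfin⟩ := exists_isFiniteLength_quotient_span_singleton hdim
  obtain ⟨r, hr⟩ := ENat.ne_top_iff_exists.1 (length_ne_top_iff.2 hfin)
  -- With r = ℓ(R/xR), the component of degree r + 1 has dimension at most r, within the r + 1 that
  -- Eakin–Sathaye allows.
  refine ⟨r, fun I hI ↦ ?_⟩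
  obtain ⟨m, hm⟩ := I.exists_radical_pow_le_of_fg I.radical.fg_of_isNoetherianRing
  have hfinI : IsFiniteLength R (R ⧸ I ^ (r + 1)) := by
    refine isFiniteLength_quotient_of_pow_le (n := m * (r + 1)) ?_
    rw [pow_mul, ← hI]
    exact Ideal.pow_right_mono hm _
  have hlen := (length_component_le I (r + 1) hx hfinI).trans hr.ge
  have hfd : Module.Finite (ResidueField R) (FiberRing.component I (r + 1)) := by
    have : Module.Finite R (FiberRing.component I (r + 1)) :=
      inferInstanceAs (Module.Finite R (LinearMap.range (FiberRing.monomial I (r + 1))))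
    exact .of_restrictScalars_finite R _ _
  rw [length_eq_finrank] at hlen
  obtain ⟨y, hy, h⟩ := exists_pow_succ_eq_span_singleton_mul I r
    ((ENat.natCast_le_natCast.1 hlen).trans r.le_succ)
  refine ⟨y, hy, fun n hn ↦ ?_⟩
  induction n, hn using Nat.le_induction with
  | base => exact h
  | succ n _ ih => rw [pow_succ, ih, mul_assoc, ← pow_succ, ih]

end IsLocalRing

/-! ### Approximation in the adic topology -/

namespace IsLocalRing

open Submodule

variable {R M : Type*} [CommRing R] [AddCommGroup M] [Module R M]

/-- A form of the Artin–Rees lemma: `(A + I ^ t M) ∩ N` is close to `A ∩ N` for large `t`. -/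
lemma _root_.Ideal.exists_sup_pow_smul_top_inf_le [IsNoetherianRing R] [Module.Finite R M]
    (I : Ideal R) (A N : Submodule R M) (k : ℕ) :
    ∃ t, k ≤ t ∧ (A ⊔ I ^ t • ⊤) ⊓ N ≤ (A ⊓ N) ⊔ I ^ k • ⊤ := by
  obtain ⟨c, hc⟩ := I.exists_pow_inf_eq_pow_smul (N.map A.mkQ)
  -- Here c is an Artin–Rees number, for this one ideal, of the image of N in M/A.
  refine ⟨k + c, Nat.le_add_right k c, ?_⟩
  rintro x ⟨hxA, hxN⟩
  have hx : A.mkQ x ∈ (I ^ k • N).map A.mkQ := by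
    rw [map_smul'']
    refine (smul_mono_right (I ^ k) inf_le_right :
      I ^ k • (I ^ c • ⊤ ⊓ N.map A.mkQ) ≤ I ^ k • N.map A.mkQ) ?_
    have h := hc (k + c) (Nat.le_add_left c k)
    rw [Nat.add_sub_cancel] at h
    rw [← h]
    refine ⟨?_, mem_map_of_mem hxN⟩
    rw [← range_mkQ A, ← Submodule.map_top, ← map_smul'']
    have h2 : A.mkQ x ∈ (A ⊔ I ^ (k + c) • ⊤).map A.mkQ := mem_map_of_mem hxA
    rwa [Submodule.map_sup, mkQ_map_self, bot_sup_eq] at h2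
  obtain ⟨z, hz, hzx⟩ := hx
  have hA : x - z ∈ A := (Submodule.Quotient.eq A).1 hzx.symm
  rw [← sub_add_cancel x z]
  exact add_mem_sup ⟨hA, N.sub_mem hxN (smul_le_right hz)⟩ (smul_mono le_rfl le_top hz)

/-- **Krull's intersection theorem**: submodules are closed in the `𝔪`-adic topology. -/
lemma mem_of_forall_mem_sup_pow_smul_top [IsLocalRing R] [IsNoetherianRing R] [Module.Finite R M]
    {P : Submodule R M} {x : M} (h : ∀ k : ℕ, x ∈ P ⊔ maximalIdeal R ^ k • ⊤) : x ∈ P := by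
  rw [← Submodule.Quotient.mk_eq_zero, ← mem_bot R,
    ← Ideal.iInf_pow_smul_eq_bot_of_isLocalRing (M := M ⧸ P) (maximalIdeal R)
      (Ideal.IsPrime.ne_top inferInstance), mem_iInf]
  intro k
  have h2 : P.mkQ x ∈ (P ⊔ maximalIdeal R ^ k • ⊤).map P.mkQ := mem_map_of_mem (h k)
  rwa [Submodule.map_sup, mkQ_map_self, bot_sup_eq, map_smul'', Submodule.map_top, range_mkQ] at h2

lemma _root_.Ideal.sup_pow_le_pow_sup (I J : Ideal R) (n : ℕ) : (I ⊔ J) ^ n ≤ I ^ n ⊔ J := by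
  induction n with
  | zero => simp
  | succ n ih =>
    rw [pow_succ, pow_succ]
    refine (Ideal.mul_mono_left ih).trans ?_
    rw [Ideal.sup_mul]
    exact sup_le ((Ideal.mul_sup _ _ _).trans_le (sup_le_sup_left Ideal.mul_le_right _))
      (Ideal.mul_le_left.trans le_sup_right)

end IsLocalRing

/-! ### Artin–Rees numbers -/

namespace ArtinRees

open IsLocalRing Submodule

section

variable {R M : Type*} [CommRing R] [AddCommGroup M] [Module R M]

lemma pow_smul_inf_le (I : Ideal R) (N : Submodule R M) {n h : ℕ} (hn : h ≤ n) :
    I ^ (n - h) • (I ^ h • (⊤ : Submodule R M) ⊓ N) ≤ I ^ n • ⊤ ⊓ N := by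
  refine le_inf ?_ (smul_le_right.trans inf_le_right)
  refine (smul_mono_right _ inf_le_left).trans ?_
  rw [← Submodule.mul_smul, ← pow_add, Nat.sub_add_cancel hn]

/-- If `I ^ (n + 1) = y I ^ n` for `n ≥ r`, and `y ^ l` kills the `y`-power torsion of `M ⧸ N`, then
`r + l` is an Artin–Rees number for `I`. -/
lemma strongEq_of_pow_eq {I : Ideal R} {N : Submodule R M} {y : R} (hy : y ∈ I) {r l : ℕ}
    (hr : ∀ n, r ≤ n → I ^ (n + 1) = Ideal.span {y} * I ^ n)
    (hl : ∀ (k : ℕ) (v : M), y ^ k • v ∈ N → y ^ l • v ∈ N) : StrongEq I N (r + l) := by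
  intro n hn
  refine le_antisymm ?_ (pow_smul_inf_le I N hn)
  obtain ⟨k, rfl⟩ := Nat.exists_eq_add_of_le hn
  have hpow (j : ℕ) : I ^ (r + j) = Ideal.span {y ^ j} * I ^ r := by
    induction j with
    | zero => simp
    | succ j ih =>
      rw [← add_assoc, hr _ (Nat.le_add_right r j), ih, ← mul_assoc,
        Ideal.span_singleton_mul_span_singleton, ← pow_succ']
  rintro u ⟨hu, huN⟩
  rw [add_assoc, hpow, Submodule.mul_smul, ideal_span_singleton_smul] at hu
  obtain ⟨v, hv, rfl⟩ := (mem_smul_pointwise_iff_exists _ _ _).1 hu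
  rw [Nat.add_sub_cancel_left]
  have hv' : y ^ (l + k) • v = y ^ k • y ^ l • v := by
    rw [smul_smul, ← pow_add, add_comm]
  change y ^ (l + k) • v ∈ _
  rw [hv']
  refine smul_mem_smul (Ideal.pow_mem_pow hy k) ⟨?_, hl _ v huN⟩
  rw [add_comm r l, pow_add, Submodule.mul_smul]
  exact smul_mem_smul (Ideal.pow_mem_pow hy l) hv

end

/-- The class of v lies in H⁰(M/N), and 𝔪^l kills a module of length at most l. -/
lemma smul_mem_of_length_H0_le {R M : Type*} [CommRing R] [IsLocalRing R] [AddCommGroup M]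
    [Module R M] {N : Submodule R M} {l : ℕ}
    (hl : Module.length R (H0 R (M ⧸ N)) ≤ l) {v : M} {k : ℕ}
    (hv : ∀ a ∈ maximalIdeal R ^ k, a • v ∈ N) {b : R} (hb : b ∈ maximalIdeal R ^ l) :
    b • v ∈ N := by
  have hvH : (Submodule.Quotient.mk v : M ⧸ N) ∈ H0 R (M ⧸ N) := by
    rw [Ideal.primaryComponent_mem]
    refine ⟨k, (mem_torsionBySet_iff _ _).2 fun a ↦ ?_⟩
    rw [← Submodule.Quotient.mk_smul, Submodule.Quotient.mk_eq_zero]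
    exact hv a a.2
  have h0 : b • (⟨_, hvH⟩ : H0 R (M ⧸ N)) = 0 := by
    rw [← mem_bot R, ← Module.pow_maximalIdeal_smul_top_eq_bot_of_length_le l hl]
    exact smul_mem_smul hb mem_top
  have h1 := congrArg Subtype.val h0
  rwa [SetLike.val_smul, ← Submodule.Quotient.mk_smul, ZeroMemClass.coe_zero,
    Submodule.Quotient.mk_eq_zero] at h1

variable {R M : Type*} [CommRing R] [IsLocalRing R] [IsNoetherianRing R] [AddCommGroup M]
  [Module R M] [Module.Finite R M]

/-- Strong Artin–Rees equalities for the ideals `I + 𝔪 ^ t`, `t ≥ 1`, pass to `I`. -/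
lemma strongEq_of_forall_sup_pow {I : Ideal R} {N : Submodule R M} {h : ℕ}
    (H : ∀ t : ℕ, t ≠ 0 → StrongEq (I ⊔ maximalIdeal R ^ t) N h) : StrongEq I N h := by
  intro n hn
  refine le_antisymm (fun u hu ↦ mem_of_forall_mem_sup_pow_smul_top fun k ↦ ?_)
    (pow_smul_inf_le I N hn)
  -- For large t, passing from I to I + 𝔪^t changes the right-hand side only within 𝔪^k M. The
  -- exponent k + 1 forces t ≠ 0.
  obtain ⟨t, hkt, ht⟩ :=
    (maximalIdeal R).exists_sup_pow_smul_top_inf_le (I ^ h • ⊤) N (k + 1)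
  have hle : (I ⊔ maximalIdeal R ^ t) ^ h • (⊤ : Submodule R M) ⊓ N ≤
      I ^ h • ⊤ ⊓ N ⊔ maximalIdeal R ^ k • ⊤ := by
    refine (inf_le_inf_right _ ?_).trans (ht.trans (sup_le_sup_left
      (smul_mono_left (Ideal.pow_le_pow_right k.le_succ)) _))
    rw [← sup_smul]
    exact smul_mono_left (Ideal.sup_pow_le_pow_sup _ _ _)
  have hu' : u ∈ (I ⊔ maximalIdeal R ^ t) ^ n • (⊤ : Submodule R M) ⊓ N :=
    ⟨smul_mono_left (Ideal.pow_right_mono le_sup_left n) hu.1, hu.2⟩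
  rw [H t (by omega) n hn] at hu'
  have hu2 := smul_mono ((Ideal.sup_pow_le_pow_sup I (maximalIdeal R ^ t) (n - h)).trans
    (sup_le_sup_left (Ideal.pow_le_pow_right (by omega : k ≤ t)) _)) hle hu'
  refine (?_ : _ ≤ I ^ (n - h) • (I ^ h • ⊤ ⊓ N) ⊔ maximalIdeal R ^ k • ⊤) hu2
  rw [sup_smul, smul_sup]
  exact sup_le (sup_le_sup_left smul_le_right _)
    ((smul_mono_right _ le_top).trans le_sup_right)

/-- The chain of 𝔪^i-torsion submodules stabilizes, so a single power of 𝔪 kills H⁰. -/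
lemma isFiniteLength_H0 : IsFiniteLength R (H0 R M) := by
  have hmono : Monotone fun i : ℕ ↦ torsionBySet R M (maximalIdeal R ^ i : Ideal R) :=
    fun i j hij ↦ torsionBySet_le_torsionBySet_of_subset (Ideal.pow_le_pow_right hij)
  obtain ⟨n, hn⟩ := monotone_stabilizes_iff_noetherian.2 (inferInstance : IsNoetherian R M)
    ⟨_, hmono⟩
  refine Module.isFiniteLength_of_pow_maximalIdeal_smul_eq_bot (n := n) ?_
  refine eq_bot_iff.2 (smul_le.2 fun a ha x _ ↦ (mem_bot R).2 (Subtype.ext ?_))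
  obtain ⟨k, hk⟩ := (Ideal.primaryComponent_mem _ _ _).1 x.2
  have hx : (x : M) ∈ torsionBySet R M (maximalIdeal R ^ n : Ideal R) := by
    have h : torsionBySet R M (maximalIdeal R ^ n : Ideal R) =
      torsionBySet R M (maximalIdeal R ^ (max n k) : Ideal R) := hn _ (le_max_left n k)
    exact h ▸ hmono (le_max_right n k) hk
  exact (mem_torsionBySet_iff _ _).1 hx ⟨a, ha⟩

/-- If `r` is a uniform reduction bound, `s ≥ r` and `H⁰(M ⧸ N)` has length at most `l`, then `s + l`
is an Artin–Rees number of `N ≤ M` for all ideals. -/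
theorem isArtinReesNumber_of_isUniformReductionBound {r : ℕ} (hr : IsUniformReductionBound R r)
    (N : Submodule R M) {l : ℕ} (hl : Module.length R (H0 R (M ⧸ N)) ≤ l) {s : ℕ} (hs : r ≤ s) :
    IsArtinReesNumber N (s + l) := by
  intro I
  by_cases hI : I = ⊤
  · intro n _
    simp [hI, ← Ideal.one_eq_top]
  refine strongEq_of_forall_sup_pow fun t ht ↦ ?_
  have hrad : (I ⊔ maximalIdeal R ^ t).radical = maximalIdeal R := by
    refine le_antisymm ?_ fun a ha ↦ ⟨t, le_sup_right (a := I) (Ideal.pow_mem_pow ha t)⟩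
    exact Ideal.IsPrime.radical_le_iff inferInstance |>.2
      (sup_le (le_maximalIdeal hI) (Ideal.pow_le_self ht))
  obtain ⟨y, hyI, hy⟩ := hr (I ⊔ maximalIdeal R ^ t)
    (Ideal.isPrimary_of_isMaximal_radical (by rw [hrad]; infer_instance)) hrad
  have hym : y ∈ maximalIdeal R := hrad ▸ Ideal.le_radical hyI
  refine strongEq_of_pow_eq hyI (fun n hn ↦ hy (n + 1) (by omega) (by omega)) fun k v hv ↦ ?_
  -- A power of 𝔪 lies in (I + 𝔪^t)^(s+1), hence in (y); so y-power torsion modulo N is 𝔪-power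
  -- torsion.
  obtain ⟨m, hm⟩ : ∃ m, maximalIdeal R ^ m ≤ Ideal.span {y} := by
    have h1 := hy (s + 1) (by omega) (by omega)
    refine ⟨t * (s + 1), ?_⟩
    rw [pow_mul]
    refine (Ideal.pow_right_mono le_sup_right _).trans (h1.trans_le Ideal.mul_le_left)
  refine smul_mem_of_length_H0_le hl (k := m * k) (fun a ha ↦ ?_) (Ideal.pow_mem_pow hym l)
  rw [pow_mul] at ha
  have ha2 := Ideal.pow_right_mono hm k ha
  rw [Ideal.span_singleton_pow] at ha2
  obtain ⟨b, rfl⟩ := Ideal.mem_span_singleton'.1 ha2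
  rw [mul_smul]
  exact N.smul_mem b hv

end ArtinRees
theorem mainTheorem1 (R : Type u) [CommRing R] [IsLocalRing R] [IsNoetherianRing R]
    (hdim : ringKrullDim R = 1) (hk : Infinite (IsLocalRing.ResidueField R)) :
    ArtinRees.RingHasStrongUniformArtinRees.{u, v} R ∧
    (∃ r : ℕ, ArtinRees.IsUniformReductionBound R r) ∧
    ∀ r : ℕ, ArtinRees.IsUniformReductionBound R r →
      ∀ (M : Type v) [AddCommGroup M] [Module R M] [Module.Finite R M] (N : Submodule R M),
        IsFiniteLength R (ArtinRees.H0 R (M ⧸ N)) ∧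
        ArtinRees.ar N ≤
          max (r : ℕ∞) (Module.length R (ArtinRees.H0 R (M ⧸ N))) +
          Module.length R (ArtinRees.H0 R (M ⧸ N)) := by
  have hbound : ∃ r : ℕ, ArtinRees.IsUniformReductionBound R r := by
    obtain ⟨r, hr⟩ := IsLocalRing.exists_forall_pow_succ_eq_span_singleton_mul hdim
    refine ⟨r + 1, fun I _ hI ↦ ?_⟩
    obtain ⟨y, hy, h⟩ := hr I hI
    refine ⟨y, hy, fun n h1 hn ↦ ?_⟩
    obtain ⟨n, rfl⟩ := Nat.exists_eq_add_of_le' h1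
    exact h n (by omega)
  refine ⟨fun M _ _ _ N ↦ ?_, hbound, fun r hr M _ _ _ N ↦ ⟨ArtinRees.isFiniteLength_H0, ?_⟩⟩
  · obtain ⟨r, hr⟩ := hbound
    obtain ⟨l, hl⟩ := ENat.ne_top_iff_exists.1
      (Module.length_ne_top_iff.2 (ArtinRees.isFiniteLength_H0 (R := R) (M := M ⧸ N)))
    exact ⟨r + l, ArtinRees.isArtinReesNumber_of_isUniformReductionBound hr N hl.ge le_rfl⟩
  · obtain ⟨l, hl⟩ := ENat.ne_top_iff_exists.1
      (Module.length_ne_top_iff.2 (ArtinRees.isFiniteLength_H0 (R := R) (M := M ⧸ N)))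
    rw [← hl]
    -- The choice s = max r l matches the stated bound; s = r would already give r + l.
    exact (iInf₂_le (max r l + l) (ArtinRees.isArtinReesNumber_of_isUniformReductionBound hr N
      hl.ge (le_max_left r l))).trans (by push_cast; rfl)
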